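/- Let $n,d\ge 1$ be integers. For a data set $x=(x_1,\dots,x_{3n})\in(\mathbb R^d)^{3n}$ put $$\mu_x=\frac1n\sum_{i=1}^n x_{i+2n},\qquad \Sigma_x=\frac1{2n}\sum_{i=1}^n (x_i-x_{i+n})(x_i-x_{i+n})^{T},$$ and for $\lambda>0$ let $\mathcal G(\lambda)$ be the set of all $x\in(\mathbb R^d)^{3n}$ such that $\Sigma_x$ is invertible and $(x_i-\mu_x)^T\Sigma_x^{-1}(x_i-\mu_x)\le\lambda$ for every $i\in\{1,\dots,3n\}$. The Hamming distance of two data sets is $D_H(x,y)=|\{i: x_i\ne y_i\}|$. Two probability distributions $P,Q$ on the same measurable space are called $(\varepsilon,\delta)$-indistinguishable if $P(W)\le e^{\varepsilon}Q(W)+\delta$ and $Q(W)\le e^{\varepsilon}P(W)+\delta$ for every measurable set $W$. Let $\varepsilon,\delta,\lambda,k>0$ be real numbers such that $$n>2k\lambda\qquad\text{and}\qquad \varepsilon\ge 10k\lambda\left(\frac1{n-2k\lambda}+\frac1n\right)\log\frac2\delta,$$ where $\log$ is the natural logarithm, and let $C$ be a real number with $$C^2=\frac{32k^2}{\varepsilon^2n^2}\cdot\frac{\lambda}{1-2k\lambda/n}\cdot\log\frac{1.25}{\delta}.$$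 Then for all $x,y\in\mathcal G(\lambda)$ with $D_H(x,y)\le k$, the Gaussian distributions $\mathcal N(\mu_x,C^2\Sigma_x)$ and $\mathcal N(\mu_y,C^2\Sigma_y)$ are $(2\varepsilon,(1+e^{\varepsilon})\delta)$-indistinguishable. -/

import Mathlib

open scoped Matrix

namespace RescaledGaussian

/-- A data set of size `3 n` in `ℝ^d`, that is, an element of `ℝ^(3n × d)`.
The points are numbered `0, …, 3 n - 1`. -/
abbrev DataSet (n d : ℕ) : Type := Fin (3 * n) → EuclideanSpace ℝ (Fin d)

/-- Two distributions `P`, `Q` are `(ε, δ)`-indistinguishable. -/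
def Indistinguishable {W : Type*} [MeasurableSpace W] (ε δ : ℝ)
    (P Q : MeasureTheory.Measure W) : Prop :=
  ∀ s : Set W, MeasurableSet s →
    P.real s ≤ Real.exp ε * Q.real s + δ ∧ Q.real s ≤ Real.exp ε * P.real s + δ

open Classical in
/-- The Hamming distance: the number of indices at which the two data sets differ. -/
noncomputable def dist_H {n d : ℕ} (x y : DataSet n d) : ℕ := hammingDist x y

section Points

variable {n d : ℕ} (x : DataSet n d) (i : Fin n)

/-- The `i`-th point of the first third of the data set. -/
def fstPt : EuclideanSpace ℝ (Fin d) := x ⟨i, by have := i.isLt; omega⟩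

/-- The `i`-th point of the second third of the data set. -/
def sndPt : EuclideanSpace ℝ (Fin d) := x ⟨i + n, by have := i.isLt; omega⟩

/-- The `i`-th point of the last third of the data set. -/
def trdPt : EuclideanSpace ℝ (Fin d) := x ⟨i + 2 * n, by have := i.isLt; omega⟩

end Points

/-- The empirical mean `μ_x = (1 / n) ∑ᵢ x_{i+2n}`, computed from the last third. -/
noncomputable def empMean {n d : ℕ} (x : DataSet n d) : EuclideanSpace ℝ (Fin d) :=
  (1 / (n : ℝ)) • ∑ i : Fin n, trdPt x i

/-- The empirical covariance `Σ_x = (1 / (2n)) ∑ᵢ (xᵢ - x_{i+n}) (xᵢ - x_{i+n})ᵀ`, computed from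
the first two thirds. -/
noncomputable def empCov {n d : ℕ} (x : DataSet n d) : Matrix (Fin d) (Fin d) ℝ :=
  (1 / (2 * (n : ℝ))) • ∑ i : Fin n,
    Matrix.vecMulVec (fstPt x i - sndPt x i).ofLp (fstPt x i - sndPt x i).ofLp

/-- The Mahalanobis norm `‖v‖_S = ‖S^(-1/2) v‖₂ = √(vᵀ S⁻¹ v)` for a positive definite `S`. -/
noncomputable def mahalanobis {d : ℕ} (S : Matrix (Fin d) (Fin d) ℝ)
    (v : EuclideanSpace ℝ (Fin d)) : ℝ :=
  Real.sqrt (v.ofLp ⬝ᵥ (S⁻¹ *ᵥ v.ofLp))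

/-- The set `G(lam)` of good data sets. (`Σ_x` is always positive semidefinite, so it is positive
definite when it is invertible.) -/
def Good (n d : ℕ) (lam : ℝ) : Set (DataSet n d) :=
  {x | IsUnit (empCov x) ∧ ∀ i : Fin (3 * n), mahalanobis (empCov x) (x i - empMean x) ^ 2 ≤ lam}

end RescaledGaussian

/-! ### Privacy loss of product measures. -/

namespace RescaledGaussian

open MeasureTheory ProbabilityTheory
open scoped ENNReal NNReal

/-! Interpolate through `N(μ_x, C²Σ_y)`: replacing the covariance and then the mean costs `(ε, δ)`
each, and composing the two bounds gives `2ε` and `(1 + e^ε)δ`.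

Write `Σ_y = M Mᵀ` and `Σ_x = M diag(d) Mᵀ` (`exists_simultaneous_diagonalization`). Pulling back
along `C M` turns all three Gaussians into products of one-dimensional ones, with variances `d j` or
`1`. For products, the moment `E_P[(dP/dQ)^t]` factors over coordinates, and Markov's inequality for
it bounds the event `dP/dQ > e^ε` (`real_le_of_lintegral_rpow_le`). The covariance change then only
needs `∑ |1 - d j|` small, and the mean change only needs the squared distance of the rescaled means
small.

Both are stability properties of good data sets: at most `k` summands of each average change, and
each is bounded in its own Mahalanobis norm. For the covariance this gives `∑ |1 - d j| ≤ τ =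
(2kλ/n)(1 + 1/q)` with `q = 1 - 2kλ/n`, an `ℓ¹` bound free of the dimension
(`diag_cov_perturbation`); for the means see `norm_mean_sub_le`. The hypothesis on `ε` reads `5τ
log(2/δ) ≤ ε`, and `C` is calibrated to the mean bound. -/

theorem lintegral_pi_prod {ι : Type*} [Fintype ι] (μ : ι → Measure ℝ)
    [∀ i, IsProbabilityMeasure (μ i)] (f : ι → ℝ → ℝ≥0∞) (hf : ∀ i, Measurable (f i)) :
    ∫⁻ x, ∏ i, f i (x i) ∂Measure.pi μ = ∏ i, ∫⁻ y, f i y ∂μ i := by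
  rw [lintegral_prod_eq_prod_lintegral_of_indepFun Finset.univ (fun i (x : ι → ℝ) ↦ f i (x i))
    (iIndepFun_pi fun i ↦ (hf i).aemeasurable) (fun i ↦ (hf i).comp (measurable_pi_apply i))]
  refine Finset.prod_congr rfl fun i _ ↦ ?_
  rw [← lintegral_map (hf i) (measurable_pi_apply i), (measurePreserving_eval μ i).map_eq]

theorem pi_eq_withDensity_prod {ι : Type*} [Fintype ι] (P Q : ι → Measure ℝ)
    [∀ i, IsProbabilityMeasure (P i)] [∀ i, IsProbabilityMeasure (Q i)] (f : ι → ℝ → ℝ≥0∞)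
    (hf : ∀ i, Measurable (f i)) (hPQ : ∀ i, P i = (Q i).withDensity (f i)) :
    Measure.pi P = (Measure.pi Q).withDensity (fun x ↦ ∏ i, f i (x i)) := by
  refine Measure.pi_eq fun s hs ↦ ?_
  have hbox := MeasurableSet.univ_pi hs
  rw [withDensity_apply _ hbox, ← lintegral_indicator hbox]
  have : ∀ x : ι → ℝ, (Set.univ.pi s).indicator (fun x ↦ ∏ i, f i (x i)) x
      = ∏ i, (s i).indicator (f i) (x i) := by
    intro x
    by_cases hx : x ∈ Set.univ.pi s
    · rw [Set.indicator_of_mem hx]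
      exact Finset.prod_congr rfl fun i _ ↦ (Set.indicator_of_mem (hx i trivial) _).symm
    · rw [Set.indicator_of_notMem hx]
      obtain ⟨i, hi⟩ : ∃ i, x i ∉ s i := by simpa [Set.mem_pi] using hx
      exact (Finset.prod_eq_zero (Finset.mem_univ i) (Set.indicator_of_notMem hi _)).symm
  simp_rw [this]
  rw [lintegral_pi_prod Q _ fun i ↦ (hf i).indicator (hs i)]
  refine Finset.prod_congr rfl fun i _ ↦ ?_
  rw [lintegral_indicator (hs i), hPQ i, withDensity_apply _ (hs i)]

/-- A Chernoff bound on the privacy loss gives one side of approximate indistinguishability. -/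
theorem real_le_of_lintegral_rpow_le {Ω : Type*} [MeasurableSpace Ω] (P Q : Measure Ω)
    [IsProbabilityMeasure P] [IsProbabilityMeasure Q] (r : Ω → ℝ) (hr : Measurable r)
    (hPQ : P = Q.withDensity fun x ↦ ENNReal.ofReal (r x))
    {ε δ t : ℝ} (ht : 0 < t) (hδ : 0 ≤ δ)
    (h : ∫⁻ x, ENNReal.ofReal (r x ^ t) ∂P ≤ ENNReal.ofReal (Real.exp (t * ε) * δ))
    {s : Set Ω} (hs : MeasurableSet s) :
    P.real s ≤ Real.exp ε * Q.real s + δ := by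
  -- Where the density is at most `e^ε`, `P` is at most `e^ε Q`; the complement has `P`-mass at most
  -- `δ` by Markov's inequality for `r ^ t`.
  have hA : MeasurableSet {x | r x ≤ Real.exp ε} := measurableSet_le hr measurable_const
  have h1 : P (s ∩ {x | r x ≤ Real.exp ε}) ≤ ENNReal.ofReal (Real.exp ε) * Q s := by
    rw [hPQ, withDensity_apply _ (hs.inter hA)]
    calc ∫⁻ x in s ∩ {x | r x ≤ Real.exp ε}, ENNReal.ofReal (r x) ∂Q
        ≤ ∫⁻ x in s ∩ {x | r x ≤ Real.exp ε}, ENNReal.ofReal (Real.exp ε) ∂Q :=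
          setLIntegral_mono measurable_const fun x hx ↦ ENNReal.ofReal_le_ofReal hx.2
      _ = ENNReal.ofReal (Real.exp ε) * Q (s ∩ {x | r x ≤ Real.exp ε}) := by simp
      _ ≤ _ := by gcongr; exact Set.inter_subset_left
  have h2 : P {x | r x ≤ Real.exp ε}ᶜ ≤ ENNReal.ofReal δ := by
    have hm := mul_meas_ge_le_lintegral (μ := P)
      (f := fun x ↦ ENNReal.ofReal (r x ^ t)) (by fun_prop)
      (ENNReal.ofReal (Real.exp (t * ε)))
    have hsub : {x | r x ≤ Real.exp ε}ᶜ
        ⊆ {x | ENNReal.ofReal (Real.exp (t * ε)) ≤ ENNReal.ofReal (r x ^ t)} := by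
      intro x hx
      simp only [Set.mem_compl_iff, Set.mem_ofPred_eq, not_le] at hx ⊢
      apply ENNReal.ofReal_le_ofReal
      rw [mul_comm, Real.exp_mul]
      exact Real.rpow_le_rpow (Real.exp_pos _).le hx.le ht.le
    have hpos : ENNReal.ofReal (Real.exp (t * ε)) ≠ 0 := by
      simpa using Real.exp_pos _
    rw [ENNReal.ofReal_mul (Real.exp_pos _).le] at h
    have h3 : ENNReal.ofReal (Real.exp (t * ε)) * P {x | r x ≤ Real.exp ε}ᶜ
        ≤ ENNReal.ofReal (Real.exp (t * ε)) * ENNReal.ofReal δ :=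
      (mul_le_mul_right (measure_mono hsub) _).trans (hm.trans h)
    exact (ENNReal.mul_le_mul_iff_right hpos ENNReal.ofReal_ne_top).1 h3
  have h3 : P s ≤ ENNReal.ofReal (Real.exp ε) * Q s + ENNReal.ofReal δ := by
    refine (measure_le_inter_add_sdiff P s {x | r x ≤ Real.exp ε}).trans (add_le_add h1 ?_)
    exact (measure_mono fun x hx ↦ hx.2).trans h2
  have h4 := ENNReal.toReal_mono (by finiteness) h3
  rwa [ENNReal.toReal_add (by finiteness) (by finiteness), ENNReal.toReal_mul,
    ENNReal.toReal_ofReal (Real.exp_pos _).le, ENNReal.toReal_ofReal hδ] at h4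

theorem gaussianReal_eq_withDensity_ratio (m m' : ℝ) {v v' : ℝ≥0} (hv : v ≠ 0) (hv' : v' ≠ 0) :
    gaussianReal m v = (gaussianReal m' v').withDensity fun x ↦
      ENNReal.ofReal (gaussianPDFReal m v x / gaussianPDFReal m' v' x) := by
  rw [gaussianReal_of_var_ne_zero m hv, gaussianReal_of_var_ne_zero m' hv', ← withDensity_mul]
  · congr 1
    ext x
    simp only [gaussianPDF, Pi.mul_apply]
    rw [← ENNReal.ofReal_mul (gaussianPDFReal_nonneg _ _ _),
      mul_div_cancel₀ _ (gaussianPDFReal_pos m' v' x hv').ne']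
  · exact measurable_gaussianPDF _ _
  · exact ((measurable_gaussianPDFReal _ _).div (measurable_gaussianPDFReal _ _)).ennreal_ofReal

/-- Logarithmic moments add over independent coordinates, so `c i` is the budget spent by coordinate
`i` and only the sum matters. -/
theorem pi_real_le {ι : Type*} [Fintype ι] (P Q : ι → Measure ℝ)
    [∀ i, IsProbabilityMeasure (P i)] [∀ i, IsProbabilityMeasure (Q i)] (r : ι → ℝ → ℝ)
    (hmeas : ∀ i, Measurable (r i)) (hnn : ∀ i x, 0 ≤ r i x)
    (hPQ : ∀ i, P i = (Q i).withDensity fun x ↦ ENNReal.ofReal (r i x))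
    (c : ι → ℝ) {ε δ t : ℝ} (ht : 0 < t) (hδ : 0 < δ)
    (h : ∀ i, ∫⁻ x, ENNReal.ofReal (r i x ^ t) ∂P i ≤ ENNReal.ofReal (Real.exp (c i)))
    (hc : ∑ i, c i ≤ t * ε + Real.log δ) {s : Set (ι → ℝ)} (hs : MeasurableSet s) :
    (Measure.pi P).real s ≤ Real.exp ε * (Measure.pi Q).real s + δ := by
  refine real_le_of_lintegral_rpow_le _ _ (fun x ↦ ∏ i, r i (x i))
    (Finset.measurable_prod (f := fun i (x : ι → ℝ) ↦ r i (x i)) _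
      fun i _ ↦ (hmeas i).comp (measurable_pi_apply i))
    ?_ ht hδ.le ?_ hs
  · rw [pi_eq_withDensity_prod P Q _ (fun i ↦ (hmeas i).ennreal_ofReal) hPQ]
    congr 1
    ext x
    rw [ENNReal.ofReal_prod_of_nonneg fun i _ ↦ hnn i _]
  · have : ∀ x : ι → ℝ, ENNReal.ofReal ((∏ i, r i (x i)) ^ t)
        = ∏ i, ENNReal.ofReal (r i (x i) ^ t) := by
      intro x
      rw [← Real.finsetProd_rpow _ _ fun i _ ↦ hnn i _,
        ENNReal.ofReal_prod_of_nonneg fun i _ ↦ Real.rpow_nonneg (hnn i _) _]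
    simp_rw [this]
    rw [lintegral_pi_prod P (fun i x ↦ ENNReal.ofReal (r i x ^ t))
          (fun i ↦ ((hmeas i).pow_const t).ennreal_ofReal)]
    calc _ ≤ ∏ i, ENNReal.ofReal (Real.exp (c i)) := Finset.prod_le_prod' fun i _ ↦ h i
      _ = ENNReal.ofReal (Real.exp (∑ i, c i)) := by
        rw [Real.exp_sum, ENNReal.ofReal_prod_of_nonneg fun i _ ↦ (Real.exp_pos _).le]
      _ ≤ _ := by
        apply ENNReal.ofReal_le_ofReal
        calc _ ≤ Real.exp (t * ε + Real.log δ) := Real.exp_le_exp.2 hc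
          _ = _ := by rw [Real.exp_add, Real.exp_log hδ]

theorem pi_gaussianReal_real_le {ι : Type*} [Fintype ι] (m m' : ι → ℝ) (v v' : ι → ℝ≥0)
    (hv : ∀ i, v i ≠ 0) (hv' : ∀ i, v' i ≠ 0) (c : ι → ℝ) {ε δ t : ℝ} (ht : 0 < t) (hδ : 0 < δ)
    (h : ∀ i, ∫⁻ x, ENNReal.ofReal
      ((gaussianPDFReal (m i) (v i) x / gaussianPDFReal (m' i) (v' i) x) ^ t)
        ∂gaussianReal (m i) (v i) ≤ ENNReal.ofReal (Real.exp (c i)))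
    (hc : ∑ i, c i ≤ t * ε + Real.log δ) {s : Set (ι → ℝ)} (hs : MeasurableSet s) :
    (Measure.pi fun i ↦ gaussianReal (m i) (v i)).real s ≤
      Real.exp ε * (Measure.pi fun i ↦ gaussianReal (m' i) (v' i)).real s + δ :=
  pi_real_le _ _ (fun i x ↦ gaussianPDFReal (m i) (v i) x / gaussianPDFReal (m' i) (v' i) x)
    (fun _ ↦ (measurable_gaussianPDFReal _ _).div (measurable_gaussianPDFReal _ _))
    (fun _ _ ↦ div_nonneg (gaussianPDFReal_nonneg _ _ _) (gaussianPDFReal_nonneg _ _ _))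
    (fun i ↦ gaussianReal_eq_withDensity_ratio (m i) (m' i) (hv i) (hv' i)) c ht hδ h hc hs

/-! ### Moments of Gaussian density ratios and the two elementary comparisons. -/

/-- With equal variances the log-ratio is affine in `x`, so the moment is a value of the Gaussian
moment generating function. -/
theorem lintegral_ratio_rpow_of_var_one (a b t : ℝ) :
    ∫⁻ x, ENNReal.ofReal ((gaussianPDFReal a 1 x / gaussianPDFReal b 1 x) ^ t) ∂gaussianReal a 1
      = ENNReal.ofReal (Real.exp ((t + t ^ 2) / 2 * (a - b) ^ 2)) := by
  have h1 : ∀ x, (gaussianPDFReal a 1 x / gaussianPDFReal b 1 x) ^ t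
      = Real.exp (t * ((b ^ 2 - a ^ 2) / 2)) * Real.exp (t * (a - b) * x) := by
    intro x
    rw [gaussianPDFReal, gaussianPDFReal, mul_div_mul_left _ _ (by positivity), ← Real.exp_sub,
      ← Real.exp_mul, ← Real.exp_add]
    congr 1
    simp only [NNReal.coe_one]
    ring
  simp_rw [h1]
  rw [← ofReal_integral_eq_lintegral_ofReal
    ((integrable_exp_mul_gaussianReal _).const_mul _) (.of_forall fun x ↦ by positivity),
    integral_const_mul]
  have := congrFun (mgf_id_gaussianReal (μ := a) (v := 1)) (t * (a - b))
  simp only [mgf, id] at this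
  rw [this, ← Real.exp_add]
  congr 2
  simp only [NNReal.coe_one]
  ring

/-- Density times the `t`-th power of the ratio is again an unnormalized centred Gaussian in `x -
a`, with precision `(1 + t(1 - d)) / d`. It is integrable exactly when `hw` holds. -/
theorem lintegral_ratio_rpow_of_mean_eq (a t : ℝ) {d : ℝ} (hd : 0 < d)
    (hw : 0 < 1 + t * (1 - d)) :
    ∫⁻ x, ENNReal.ofReal ((gaussianPDFReal a d.toNNReal x / gaussianPDFReal a 1 x) ^ t)
        ∂gaussianReal a d.toNNReal
      = ENNReal.ofReal (Real.exp (-(t / 2) * Real.log d - Real.log (1 + t * (1 - d)) / 2)) := by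
  have hv : d.toNNReal ≠ 0 := by simpa using hd
  have hdv : (d.toNNReal : ℝ) = d := Real.coe_toNNReal _ hd.le
  set w := 1 + t * (1 - d) with hwdef
  have hpi := Real.pi_pos
  have h1 : ∀ x, gaussianPDFReal a d.toNNReal x *
      (gaussianPDFReal a d.toNNReal x / gaussianPDFReal a 1 x) ^ t
      = (√(2 * Real.pi * d))⁻¹ * Real.exp (-(t / 2) * Real.log d) *
        Real.exp (-(w / (2 * d)) * (x - a) ^ 2) := by
    intro x
    have hratio : gaussianPDFReal a d.toNNReal x / gaussianPDFReal a 1 x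
        = Real.exp (-(1 / 2) * Real.log d - (x - a) ^ 2 / 2 * (1 / d - 1)) := by
      rw [gaussianPDFReal, gaussianPDFReal, hdv, Real.exp_sub,
        show -(1 / 2) * Real.log d = - Real.log (√d) by rw [Real.log_sqrt hd.le]; ring,
        Real.exp_neg, Real.exp_log (Real.sqrt_pos.2 hd), Real.sqrt_mul (by positivity) d,
        show -(x - a) ^ 2 / (2 * d) = -(x - a) ^ 2 / 2 - (x - a) ^ 2 / 2 * (1 / d - 1) by
          field_simp; ring, Real.exp_sub]
      have : 0 < √(2 * Real.pi) := by positivity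
      have : 0 < √d := by positivity
      simp only [NNReal.coe_one, mul_one]
      field_simp
    rw [hratio, ← Real.exp_mul, gaussianPDFReal, hdv, mul_assoc, mul_assoc, ← Real.exp_add,
      mul_assoc, ← Real.exp_add]
    congr 2
    rw [hwdef]
    field_simp
    ring
  have hmeas : Measurable fun x ↦ ENNReal.ofReal
      ((gaussianPDFReal a d.toNNReal x / gaussianPDFReal a 1 x) ^ t) :=
    (((measurable_gaussianPDFReal _ _).div (measurable_gaussianPDFReal _ _)).pow_const t).ennreal_ofReal
  rw [gaussianReal_of_var_ne_zero a hv,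
    lintegral_withDensity_eq_lintegral_mul _ (measurable_gaussianPDF _ _) hmeas]
  simp only [Pi.mul_apply, gaussianPDF, ← ENNReal.ofReal_mul (gaussianPDFReal_nonneg _ _ _), h1]
  rw [lintegral_sub_right_eq_self (fun x ↦ ENNReal.ofReal ((√(2 * Real.pi * d))⁻¹ *
    Real.exp (-(t / 2) * Real.log d) * Real.exp (-(w / (2 * d)) * x ^ 2))) a,
    ← ofReal_integral_eq_lintegral_ofReal
    ((integrable_exp_neg_mul_sq (by positivity)).const_mul _) (.of_forall fun x ↦ by positivity),
    integral_const_mul, integral_gaussian]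
  congr 1
  rw [Real.exp_sub, show Real.log w / 2 = Real.log (√w) by rw [Real.log_sqrt hw.le],
    Real.exp_log (Real.sqrt_pos.2 hw),
    show Real.pi / (w / (2 * d)) = (2 * Real.pi * d) / w by field_simp,
    Real.sqrt_div (by positivity)]
  have : 0 < √(2 * Real.pi * d) := by positivity
  field_simp

/-- Gaussians with the same mean and covariances `diag d`, `1` in a common eigenbasis. -/
theorem pi_gaussianReal_real_le_of_mean_eq {ι : Type*} [Fintype ι] (a d : ι → ℝ)
    (hd : ∀ i, 0 < d i) {ε δ τ : ℝ} (hτ : 0 < τ) (hτ5 : τ ≤ 1 / 5) (hδ : 0 < δ) (hδ1 : δ ≤ 1)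
    (hsum : ∑ i, |1 - d i| ≤ τ) (hε : 5 * τ * Real.log (2 / δ) ≤ ε)
    {s : Set (ι → ℝ)} (hs : MeasurableSet s) :
    (Measure.pi fun i ↦ gaussianReal (a i) (d i).toNNReal).real s ≤
      Real.exp ε * (Measure.pi fun i ↦ gaussianReal (a i) 1).real s + δ := by
  -- This `t` keeps `t |1 - d i| ≤ 1/2`, so the integrability factor `1 + t(1 - d i)` stays at least
  -- `1/2`.
  set t := 1 / (2 * τ) with ht
  have ht0 : 0 < t := by positivity
  have htτ : t * τ = 1 / 2 := by rw [ht]; field_simp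
  have hb : ∀ i, |1 - d i| ≤ τ := fun i ↦
    (Finset.single_le_sum (fun j _ ↦ abs_nonneg (1 - d j)) (Finset.mem_univ i)).trans hsum
  have hw : ∀ i, 1 / 2 ≤ 1 + t * (1 - d i) := by
    intro i
    have := mul_le_mul_of_nonneg_left (neg_le_of_abs_le (hb i)) ht0.le
    linarith
  have hd5 : ∀ i, 4 / 5 ≤ d i := fun i ↦ by have := le_of_abs_le (hb i); linarith
  -- Bounding both logarithms by `log u ≥ 1 - 1/u`, the terms linear in `1 - d i` cancel and a
  -- quadratic cost remains; `d i ≥ 4/5` and `1 + t(1 - d i) ≥ 1/2` supply its constants.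
  refine pi_gaussianReal_real_le a a _ (fun _ ↦ 1) (fun i ↦ by simpa using hd i) (by simp)
    (fun i ↦ (5 / 8 * t + t ^ 2) * (1 - d i) ^ 2) ht0 hδ (fun i ↦ ?_) ?_ hs
  · rw [lintegral_ratio_rpow_of_mean_eq _ _ (hd i) (by have := hw i; linarith)]
    apply ENNReal.ofReal_le_ofReal
    apply Real.exp_le_exp.2
    have hdi := hd i
    have hwi : 0 < 1 + t * (1 - d i) := by have := hw i; linarith
    have e1 := Real.one_sub_inv_le_log_of_pos hdi
    have e2 := Real.one_sub_inv_le_log_of_pos hwi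
    have f1 : (d i)⁻¹ - 1 ≤ (1 - d i) + 5 / 4 * (1 - d i) ^ 2 := by
      have : (d i)⁻¹ - 1 = (1 - d i) + (d i)⁻¹ * (1 - d i) ^ 2 := by field_simp; ring
      rw [this]
      have : (d i)⁻¹ ≤ 5 / 4 := by
        rw [inv_le_comm₀ hdi (by norm_num)]; have := hd5 i; norm_num; linarith
      gcongr
    have f2 : (1 + t * (1 - d i))⁻¹ - 1 ≤ -(t * (1 - d i)) + 2 * (t * (1 - d i)) ^ 2 := by
      have : (1 + t * (1 - d i))⁻¹ - 1
          = -(t * (1 - d i)) + (1 + t * (1 - d i))⁻¹ * (t * (1 - d i)) ^ 2 := by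
        field_simp; ring
      rw [this]
      have : (1 + t * (1 - d i))⁻¹ ≤ 2 := by
        rw [inv_le_comm₀ hwi (by norm_num)]; have := hw i; norm_num; linarith
      gcongr
    have g1 : -(t / 2) * Real.log (d i) ≤ t / 2 * ((1 - d i) + 5 / 4 * (1 - d i) ^ 2) := by
      have : -Real.log (d i) ≤ (1 - d i) + 5 / 4 * (1 - d i) ^ 2 := by linarith
      have := mul_le_mul_of_nonneg_left this (by positivity : 0 ≤ t / 2)
      linarith
    have : (5 / 8 * t + t ^ 2) * (1 - d i) ^ 2 = t / 2 * ((1 - d i) + 5 / 4 * (1 - d i) ^ 2)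
      + (-(t * (1 - d i)) + 2 * (t * (1 - d i)) ^ 2) / 2 := by ring
    linarith
  -- The total cost is at most `5τ/16 + 1/4 ≤ 5/16`, while `tε + log δ ≥ (5/2) log 2 - (3/2) log δ ≥
  -- (5/2) log 2`.
  · rw [← Finset.mul_sum]
    have hsq : ∑ i, (1 - d i) ^ 2 ≤ τ ^ 2 := by
      calc ∑ i, (1 - d i) ^ 2 ≤ ∑ i, τ * |1 - d i| := Finset.sum_le_sum fun i _ ↦ by
            rw [← sq_abs, sq]; exact mul_le_mul_of_nonneg_right (hb i) (abs_nonneg _)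
        _ ≤ τ ^ 2 := by rw [← Finset.mul_sum, sq]; gcongr
    have h1 := mul_le_mul_of_nonneg_left hsq (by positivity : 0 ≤ 5 / 8 * t + t ^ 2)
    have h2 : (5 / 8 * t + t ^ 2) * τ ^ 2 = 5 / 16 * τ + 1 / 4 := by
      linear_combination (5 / 8 * τ + t * τ + 1 / 2) * htτ
    have h3 := mul_le_mul_of_nonneg_left hε ht0.le
    have h4 : t * (5 * τ * Real.log (2 / δ)) = 5 / 2 * Real.log (2 / δ) := by
      linear_combination (5 * Real.log (2 / δ)) * htτ
    rw [Real.log_div (by norm_num) hδ.ne'] at h3 h4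
    have := Real.log_two_gt_d9
    have := Real.log_nonpos hδ.le hδ1
    linarith

/-- Gaussians with identity covariance and different means. -/
theorem pi_gaussianReal_real_le_of_var_one {ι : Type*} [Fintype ι] (a b : ι → ℝ)
    {ε δ L : ℝ} (hε : 0 < ε) (hδ : 0 < δ) (hεL : ε ≤ L) (hL : -Real.log δ ≤ L)
    (hsum : ∑ i, (a i - b i) ^ 2 ≤ ε ^ 2 / (4 * L))
    {s : Set (ι → ℝ)} (hs : MeasurableSet s) :
    (Measure.pi fun i ↦ gaussianReal (a i) 1).real s ≤
      Real.exp ε * (Measure.pi fun i ↦ gaussianReal (b i) 1).real s + δ := by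
  have hL0 : 0 < L := hε.trans_le hεL
  -- With `t = 2L/ε` the total cost is at most `ε/4 + L/2 ≤ 3L/4`, and the budget `tε + log δ = 2L +
  -- log δ` is at least `L`.
  refine pi_gaussianReal_real_le a b (fun _ ↦ 1) (fun _ ↦ 1) (by simp) (by simp)
    (fun i ↦ (2 * L / ε + (2 * L / ε) ^ 2) / 2 * (a i - b i) ^ 2) (t := 2 * L / ε)
    (by positivity) hδ (fun i ↦ (lintegral_ratio_rpow_of_var_one _ _ _).le) ?_ hs
  rw [← Finset.mul_sum]
  have h1 := mul_le_mul_of_nonneg_left hsum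
    (by positivity : 0 ≤ (2 * L / ε + (2 * L / ε) ^ 2) / 2)
  have h2 : (2 * L / ε + (2 * L / ε) ^ 2) / 2 * (ε ^ 2 / (4 * L)) = ε / 4 + L / 2 := by
    field_simp; ring
  have h3 : 2 * L / ε * ε = 2 * L := by field_simp
  linarith

/-! ### Common coordinates for two covariances. -/

open scoped MatrixOrder in
/-- Two positive definite matrices are simultaneously diagonal as quadratic forms. -/
theorem exists_simultaneous_diagonalization {ι : Type*} [Fintype ι] [DecidableEq ι]
    {A B : Matrix ι ι ℝ} (hA : A.PosDef) (hB : B.PosDef) :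
    ∃ (M : Matrix ι ι ℝ) (d : ι → ℝ), IsUnit M ∧ (∀ i, 0 < d i) ∧ A = M * Mᵀ ∧
      B = M * Matrix.diagonal d * Mᵀ := by
  obtain ⟨Y, hY⟩ := CStarAlgebra.nonneg_iff_eq_star_mul_self.mp hA.posSemidef.nonneg
  have hYu : IsUnit Y := by
    have h := hA.isUnit
    rw [hY, Matrix.isUnit_iff_isUnit_det, Matrix.det_mul] at h
    exact (Matrix.isUnit_iff_isUnit_det _).2 (isUnit_of_mul_isUnit_right h)
  set M₀ : Matrix ι ι ℝ := star Y with hM₀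
  have hM₀u : IsUnit M₀ := hYu.star
  have hdet : IsUnit M₀.det := (Matrix.isUnit_iff_isUnit_det _).1 hM₀u
  have hYM : Y = star M₀ := by rw [hM₀, star_star]
  -- The congruence by `M₀⁻¹` takes `A` to the identity and `B` to `T`; an orthogonal
  -- diagonalization of `T` preserves the identity.
  set T := M₀⁻¹ * B * star (M₀⁻¹) with hT
  have hTpos : T.PosDef :=
    (Matrix.IsUnit.posDef_star_right_conjugate_iff
      ((Matrix.isUnit_nonsing_inv_iff).2 hM₀u)).2 hB
  have hBT : B = M₀ * T * star M₀ := by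
    rw [hT, Matrix.mul_assoc, Matrix.mul_assoc, Matrix.mul_assoc, ← star_mul,
      Matrix.mul_nonsing_inv _ hdet, star_one, Matrix.mul_one, ← Matrix.mul_assoc,
      Matrix.mul_nonsing_inv _ hdet, Matrix.one_mul]
  set U := hTpos.1.eigenvectorUnitary with hU
  have hspec : T = (U : Matrix ι ι ℝ) * Matrix.diagonal hTpos.1.eigenvalues
      * star (U : Matrix ι ι ℝ) := by
    conv_lhs => rw [hTpos.1.spectral_theorem]
    rfl
  have htr : ∀ X : Matrix ι ι ℝ, Xᵀ = star X := fun X ↦ by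
    rw [Matrix.star_eq_conjTranspose, Matrix.conjTranspose_eq_transpose_of_trivial]
  refine ⟨M₀ * (U : Matrix ι ι ℝ), hTpos.1.eigenvalues, hM₀u.mul (Unitary.isUnit_coe),
    hTpos.eigenvalues_pos, ?_, ?_⟩
  · rw [htr, star_mul, Matrix.mul_assoc, ← Matrix.mul_assoc _ (star _) (star M₀),
      Unitary.mul_star_self_of_mem U.2, Matrix.one_mul, hY, ← hYM]
  · rw [htr, star_mul]
    calc B = M₀ * T * star M₀ := hBT
      _ = M₀ * ((U : Matrix ι ι ℝ) * Matrix.diagonal hTpos.1.eigenvalues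
          * star (U : Matrix ι ι ℝ)) * star M₀ := congrArg (M₀ * · * star M₀) hspec
      _ = _ := by simp only [Matrix.mul_assoc]

/-- Both sides have the same characteristic function: on the product side it factors, with frequency
`Nᵀ t`. -/
theorem map_pi_gaussianReal_eq_multivariateGaussian {ι : Type*} [Fintype ι] [DecidableEq ι]
    (N : Matrix ι ι ℝ) (a d : ι → ℝ) (hd : ∀ i, 0 ≤ d i) :
    (Measure.pi fun i ↦ gaussianReal (a i) (d i).toNNReal).map
        (fun z ↦ WithLp.toLp 2 (N *ᵥ z)) =
      multivariateGaussian (WithLp.toLp 2 (N *ᵥ a)) (N * Matrix.diagonal d * Nᵀ) := by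
  have hps : (N * Matrix.diagonal d * Nᵀ).PosSemidef := by
    rw [← Matrix.conjTranspose_eq_transpose_of_trivial]
    exact (Matrix.PosSemidef.diagonal hd).mul_mul_conjTranspose_same N
  have hmeas : Measurable fun z : ι → ℝ ↦ (WithLp.toLp 2 (N *ᵥ z) : EuclideanSpace ℝ ι) :=
    ((PiLp.continuous_toLp 2 _).comp
      (Continuous.matrix_mulVec continuous_const continuous_id)).measurable
  have : IsProbabilityMeasure ((Measure.pi fun i ↦ gaussianReal (a i) (d i).toNNReal).map
        (fun z ↦ (WithLp.toLp 2 (N *ᵥ z) : EuclideanSpace ℝ ι))) :=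
    Measure.isProbabilityMeasure_map hmeas.aemeasurable
  apply Measure.ext_of_charFun
  ext t
  have hin : ∀ z : ι → ℝ, inner ℝ (WithLp.toLp 2 (N *ᵥ z) : EuclideanSpace ℝ ι) t
      = ∑ i, z i * (Nᵀ *ᵥ t.ofLp) i := by
    intro z
    rw [EuclideanSpace.inner_eq_star_dotProduct]
    simp only [star_trivial]
    rw [Matrix.dotProduct_mulVec, ← Matrix.mulVec_transpose, dotProduct_comm]
    rfl
  rw [charFun_multivariateGaussian hps, charFun_apply,
    integral_map hmeas.aemeasurable (Measurable.aestronglyMeasurable (by fun_prop))]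
  simp_rw [hin, Complex.ofReal_sum, Finset.sum_mul, Complex.exp_sum]
  rw [integral_fintype_prod_eq_prod
    (f := fun i x ↦ Complex.exp (((x * (Nᵀ *ᵥ t.ofLp) i : ℝ) : ℂ) * Complex.I))]
  have h1 : ∀ i, ∫ x, Complex.exp (((x * (Nᵀ *ᵥ t.ofLp) i : ℝ) : ℂ) * Complex.I)
      ∂gaussianReal (a i) (d i).toNNReal =
      Complex.exp ((a i * (Nᵀ *ᵥ t.ofLp) i : ℝ) * Complex.I
        - ((d i * (Nᵀ *ᵥ t.ofLp) i ^ 2 / 2 : ℝ) : ℂ)) := by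
    intro i
    have := charFun_gaussianReal (μ := a i) (v := (d i).toNNReal) ((Nᵀ *ᵥ t.ofLp) i)
    rw [charFun_apply_real] at this
    have e : ∀ x : ℝ, Complex.exp (((x * (Nᵀ *ᵥ t.ofLp) i : ℝ) : ℂ) * Complex.I)
      = Complex.exp ((((Nᵀ *ᵥ t.ofLp) i : ℝ) : ℂ) * x * Complex.I) := by
      intro x; push_cast; ring_nf
    simp_rw [e]
    rw [this]
    congr 1
    rw [show (((d i).toNNReal : ℝ≥0) : ℂ) = (d i : ℂ) by
      rw [← Complex.ofReal_inj.2 (Real.coe_toNNReal _ (hd i))]]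
    push_cast
    ring
  simp_rw [h1]
  rw [← Complex.exp_sum]
  congr 1
  rw [Finset.sum_sub_distrib, ← Finset.sum_mul, ← Complex.ofReal_sum, ← Complex.ofReal_sum,
    ← hin, real_inner_comm]
  congr 2
  rw [← Matrix.mulVec_mulVec, ← Matrix.mulVec_mulVec, Matrix.dotProduct_mulVec,
    ← Matrix.mulVec_transpose, dotProduct]
  push_cast
  rw [Finset.sum_div]
  refine Finset.sum_congr rfl fun i _ ↦ ?_
  rw [Matrix.mulVec_diagonal]
  push_cast
  ring

end RescaledGaussian

/-! ### Stability of the empirical covariance and mean. -/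

namespace RescaledGaussian

/-- In coordinates where one covariance is the identity and the other is `diag d`, changing few
of the points moves `d` away from `1` only a little in `ℓ¹`. -/
theorem diag_cov_perturbation {ι : Type*} [Fintype ι] {n : ℕ} (hn : 0 < n)
    {lam k q : ℝ} (hlam : 0 ≤ lam) (hq : q = 1 - 2 * k * lam / n) (hq0 : 0 < q)
    (U V : Fin n → ι → ℝ) (d : ι → ℝ) (hd : ∀ j, 0 < d j) (K : Finset (Fin n))
    (hK : (K.card : ℝ) ≤ k) (hUV : ∀ i, i ∉ K → U i = V i)
    (hdU : ∀ j, d j = 1 / (2 * (n : ℝ)) * ∑ i, U i j ^ 2)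
    (h1V : ∀ j, 1 = 1 / (2 * (n : ℝ)) * ∑ i, V i j ^ 2)
    (hU : ∀ i, ∑ j, U i j ^ 2 / d j ≤ 4 * lam) (hV : ∀ i, ∑ j, V i j ^ 2 ≤ 4 * lam) :
    (∀ j, q * d j ≤ 1) ∧ ∑ j, |1 - d j| ≤ 2 * k * lam / n * (1 + 1 / q) := by
  have hn' : (0 : ℝ) < n := by exact_mod_cast hn
  have hdiff : ∀ j, d j - 1 = 1 / (2 * (n : ℝ)) * ∑ i ∈ K, (U i j ^ 2 - V i j ^ 2) := by
    intro j
    have : ∑ i, (U i j ^ 2 - V i j ^ 2) = ∑ i ∈ K, (U i j ^ 2 - V i j ^ 2) := by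
      symm
      refine Finset.sum_subset (Finset.subset_univ _) fun i _ hi ↦ ?_
      rw [hUV i hi, sub_self]
    rw [← this, Finset.sum_sub_distrib, mul_sub, ← hdU, ← h1V]
  have hUj : ∀ i j, U i j ^ 2 ≤ 4 * lam * d j := by
    intro i j
    have := (Finset.single_le_sum (f := fun j ↦ U i j ^ 2 / d j)
      (fun j _ ↦ div_nonneg (sq_nonneg _) (hd j).le) (Finset.mem_univ j)).trans (hU i)
    rwa [div_le_iff₀ (hd j)] at this
  -- The changed terms are themselves bounded by multiples of `d j`, giving `d j - 1 ≤ (2kλ/n) d j`.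
  -- This allows the norm of one data set to be traded for that of the other at the price `1/q`.
  have hqd : ∀ j, q * d j ≤ 1 := by
    intro j
    have h1 : ∑ i ∈ K, (U i j ^ 2 - V i j ^ 2) ≤ k * (4 * lam * d j) := by
      calc ∑ i ∈ K, (U i j ^ 2 - V i j ^ 2) ≤ ∑ i ∈ K, 4 * lam * d j :=
            Finset.sum_le_sum fun i _ ↦ by have := hUj i j; nlinarith [sq_nonneg (V i j)]
        _ = K.card * (4 * lam * d j) := by simp
        _ ≤ _ := by have := (hd j).le; gcongr
    have h2 := mul_le_mul_of_nonneg_left h1 (by positivity : 0 ≤ 1 / (2 * (n : ℝ)))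
    rw [← hdiff] at h2
    have h3 : 1 / (2 * (n : ℝ)) * (k * (4 * lam * d j)) = 2 * k * lam / n * d j := by
      field_simp; ring
    rw [hq]
    linarith
  refine ⟨hqd, ?_⟩
  have hUq : ∀ i, ∑ j, U i j ^ 2 ≤ 4 * lam / q := by
    intro i
    rw [le_div_iff₀ hq0, Finset.sum_mul]
    refine (Finset.sum_le_sum fun j _ ↦ ?_).trans (hU i)
    rw [le_div_iff₀ (hd j), mul_assoc]
    exact mul_le_of_le_one_right (sq_nonneg _) (hqd j)
  calc ∑ j, |1 - d j| ≤ ∑ j, 1 / (2 * (n : ℝ)) * ∑ i ∈ K, (U i j ^ 2 + V i j ^ 2) := by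
        refine Finset.sum_le_sum fun j _ ↦ ?_
        rw [abs_sub_comm, hdiff, abs_mul, abs_of_pos (by positivity : 0 < 1 / (2 * (n : ℝ)))]
        gcongr
        refine (Finset.abs_sum_le_sum_abs _ _).trans (Finset.sum_le_sum fun i _ ↦ ?_)
        refine (abs_sub _ _).trans_eq ?_
        rw [abs_of_nonneg (sq_nonneg _), abs_of_nonneg (sq_nonneg _)]
    _ = 1 / (2 * (n : ℝ)) * ∑ i ∈ K, (∑ j, U i j ^ 2 + ∑ j, V i j ^ 2) := by
        rw [← Finset.mul_sum, Finset.sum_comm]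
        simp_rw [Finset.sum_add_distrib]
    _ ≤ 1 / (2 * (n : ℝ)) * ∑ i ∈ K, (4 * lam / q + 4 * lam) := by
        gcongr with i _
        · exact hUq i
        · exact hV i
    _ = 1 / (2 * (n : ℝ)) * (K.card * (4 * lam / q + 4 * lam)) := by
        rw [Finset.sum_const, nsmul_eq_mul]
    _ ≤ 1 / (2 * (n : ℝ)) * (k * (4 * lam / q + 4 * lam)) := by gcongr
    _ = _ := by field_simp; ring

/-- Each changed summand is centred at its own mean; the resulting `mx - my` terms, at most `k` of
them, are absorbed on the left. -/
theorem norm_mean_sub_le {E : Type*} [NormedAddCommGroup E] [NormedSpace ℝ E] {n : ℕ}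
    (hn : 0 < n) (X Y : Fin n → E) (K : Finset (Fin n)) {k a b : ℝ} (ha : 0 ≤ a) (hb : 0 ≤ b)
    (hK : (K.card : ℝ) ≤ k) (hXY : ∀ i, i ∉ K → X i = Y i) {mx my : E}
    (hmx : mx = (1 / (n : ℝ)) • ∑ i, X i) (hmy : my = (1 / (n : ℝ)) • ∑ i, Y i)
    (hX : ∀ i, ‖X i - mx‖ ≤ a) (hY : ∀ i, ‖Y i - my‖ ≤ b) :
    (n - k) * ‖mx - my‖ ≤ k * (a + b) := by
  have hn' : (0 : ℝ) < n := by exact_mod_cast hn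
  have h1 : (n : ℝ) • (mx - my) = ∑ i ∈ K, ((X i - mx) - (Y i - my) + (mx - my)) := by
    have : ∑ i, (X i - Y i) = ∑ i ∈ K, (X i - Y i) := by
      symm
      refine Finset.sum_subset (Finset.subset_univ _) fun i _ hi ↦ ?_
      rw [hXY i hi, sub_self]
    calc (n : ℝ) • (mx - my) = ∑ i, (X i - Y i) := by
          rw [hmx, hmy, ← smul_sub, smul_smul, mul_one_div_cancel hn'.ne', one_smul,
            Finset.sum_sub_distrib]
      _ = _ := by
          rw [this]
          exact Finset.sum_congr rfl fun i _ ↦ by abel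
  have h2 : (n : ℝ) * ‖mx - my‖ ≤ k * (a + b + ‖mx - my‖) := by
    calc (n : ℝ) * ‖mx - my‖ = ‖(n : ℝ) • (mx - my)‖ := by
          rw [norm_smul, Real.norm_of_nonneg hn'.le]
      _ ≤ ∑ i ∈ K, (a + b + ‖mx - my‖) := by
          rw [h1]
          refine norm_sum_le_of_le _ fun i _ ↦ ?_
          refine (norm_add_le _ _).trans (add_le_add_left ?_ _)
          exact (norm_sub_le _ _).trans (add_le_add (hX i) (hY i))
      _ = K.card * (a + b + ‖mx - my‖) := by rw [Finset.sum_const, nsmul_eq_mul]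
      _ ≤ _ := by gcongr
  linarith

theorem mahalanobis_sq_of_eq {m : ℕ} {M : Matrix (Fin m) (Fin m) ℝ} (hM : IsUnit M)
    {d : Fin m → ℝ} (hd : ∀ j, 0 < d j) (v : EuclideanSpace ℝ (Fin m)) :
    mahalanobis (M * Matrix.diagonal d * Mᵀ) v ^ 2 = ∑ j, (M⁻¹ *ᵥ v.ofLp) j ^ 2 / d j := by
  have hdet : IsUnit M.det := (Matrix.isUnit_iff_isUnit_det _).1 hM
  have hinv : (M * Matrix.diagonal d * Mᵀ)⁻¹
      = (M⁻¹)ᵀ * (Matrix.diagonal fun j ↦ (d j)⁻¹) * M⁻¹ := by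
    rw [Matrix.mul_inv_rev, Matrix.mul_inv_rev, Matrix.transpose_nonsing_inv, Matrix.mul_assoc]
    congr 2
    refine Matrix.inv_eq_right_inv ?_
    rw [Matrix.diagonal_mul_diagonal, ← Matrix.diagonal_one]
    congr 1
    ext j
    exact mul_inv_cancel₀ (hd j).ne'
  have hform : v.ofLp ⬝ᵥ ((M * Matrix.diagonal d * Mᵀ)⁻¹ *ᵥ v.ofLp)
      = ∑ j, (M⁻¹ *ᵥ v.ofLp) j ^ 2 / d j := by
    rw [hinv, ← Matrix.mulVec_mulVec, ← Matrix.mulVec_mulVec, Matrix.dotProduct_mulVec,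
      ← Matrix.mulVec_transpose, Matrix.transpose_transpose, dotProduct]
    refine Finset.sum_congr rfl fun j _ ↦ ?_
    rw [Matrix.mulVec_diagonal]
    field_simp
  rw [mahalanobis, hform, Real.sq_sqrt]
  exact Finset.sum_nonneg fun j _ ↦ div_nonneg (sq_nonneg _) (hd j).le

theorem diag_of_empCov_eq {n m : ℕ} {x : DataSet n m} {M : Matrix (Fin m) (Fin m) ℝ}
    (hM : IsUnit M) {d : Fin m → ℝ} (h : empCov x = M * Matrix.diagonal d * Mᵀ) (j : Fin m) :
    d j = 1 / (2 * (n : ℝ)) * ∑ i, (M⁻¹ *ᵥ (fstPt x i - sndPt x i).ofLp) j ^ 2 := by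
  have hdet : IsUnit M.det := (Matrix.isUnit_iff_isUnit_det _).1 hM
  have h1 : M⁻¹ * empCov x * (M⁻¹)ᵀ = Matrix.diagonal d := by
    rw [h, ← Matrix.mul_assoc, ← Matrix.mul_assoc, Matrix.nonsing_inv_mul _ hdet, Matrix.one_mul,
      Matrix.mul_assoc, ← Matrix.transpose_mul, Matrix.nonsing_inv_mul _ hdet,
      Matrix.transpose_one, Matrix.mul_one]
  have h2 := congrFun (congrFun h1 j) j
  rw [Matrix.diagonal_apply_eq, empCov, Matrix.mul_smul, Matrix.smul_mul, Matrix.smul_apply,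
    Matrix.mul_sum, Matrix.sum_mul, Matrix.sum_apply, smul_eq_mul] at h2
  rw [← h2]
  congr 1
  refine Finset.sum_congr rfl fun i _ ↦ ?_
  rw [Matrix.mul_vecMulVec, Matrix.vecMulVec_mul, Matrix.vecMul_transpose,
    Matrix.vecMulVec_apply, sq]

theorem posDef_empCov {n m : ℕ} {x : DataSet n m} (h : IsUnit (empCov x)) :
    (empCov x).PosDef := by
  refine (Matrix.PosSemidef.posDef_iff_isUnit ?_).2 h
  refine Matrix.PosSemidef.smul (Matrix.posSemidef_sum _ fun i _ ↦ ?_) (by positivity)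
  simpa using Matrix.posSemidef_vecMulVec_self_star (fstPt x i - sndPt x i).ofLp

theorem card_le_dist_H {n m : ℕ} {x y : DataSet n m} (K : Finset (Fin n))
    (f : Fin n → Fin (3 * n)) (hf : Function.Injective f) (h : ∀ i ∈ K, x (f i) ≠ y (f i)) :
    K.card ≤ dist_H x y := by
  classical
  rw [dist_H, hammingDist]
  refine Finset.card_le_card_of_injOn f (fun i hi ↦ ?_) hf.injOn
  simpa using h i hi

end RescaledGaussian

/-! ### Good data sets and the final composition. -/

namespace RescaledGaussian

/-- For good data sets at small Hamming distance, the covariances are close and the means are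
close, in coordinates diagonalizing both covariances. -/
theorem exists_common_coordinates {n m : ℕ} (hn : 0 < n) {lam k q : ℝ} (hlam : 0 < lam)
    (hk : 0 < k) (hq : q = 1 - 2 * k * lam / n) (hsmall : 2 * k * lam / n ≤ 1 / 10)
    {x y : DataSet n m} (hx : x ∈ Good n m lam) (hy : y ∈ Good n m lam)
    (hxy : (dist_H x y : ℝ) ≤ k) :
    ∃ (M : Matrix (Fin m) (Fin m) ℝ) (d : Fin m → ℝ), IsUnit M ∧ (∀ j, 0 < d j) ∧
      empCov y = M * Mᵀ ∧ empCov x = M * Matrix.diagonal d * Mᵀ ∧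
      ∑ j, |1 - d j| ≤ 2 * k * lam / n * (1 + 1 / q) ∧
      ∑ j, (M⁻¹ *ᵥ (empMean x - empMean y).ofLp) j ^ 2 ≤ 8 * k ^ 2 * lam / (q * n ^ 2) := by
  classical
  have hn' : (0 : ℝ) < n := by exact_mod_cast hn
  have hq0 : 0 < q := by rw [hq]; linarith
  obtain ⟨M, d, hM, hd, hA, hB⟩ :=
    exists_simultaneous_diagonalization (posDef_empCov hy.1) (posDef_empCov hx.1)
  have hA' : empCov y = M * Matrix.diagonal (fun _ ↦ 1) * Mᵀ := by
    rw [Matrix.diagonal_one, Matrix.mul_one, hA]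
  have hxi : ∀ i, ∑ j, (M⁻¹ *ᵥ (x i - empMean x).ofLp) j ^ 2 / d j ≤ lam := by
    intro i
    rw [← mahalanobis_sq_of_eq hM hd, ← hB]
    exact hx.2 i
  have hyi : ∀ i, ∑ j, (M⁻¹ *ᵥ (y i - empMean y).ofLp) j ^ 2 ≤ lam := by
    intro i
    have := mahalanobis_sq_of_eq hM (d := fun _ ↦ 1) (by simp) (y i - empMean y)
    simp only [div_one] at this
    rw [← this, ← hA']
    exact hy.2 i
  -- Centring a difference at the mean costs a factor 2 per point, so pair differences have squared
  -- norm at most `2λ + 2λ = 4λ`.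
  have hsplit : ∀ a b c : EuclideanSpace ℝ (Fin m), ∀ j, (M⁻¹ *ᵥ (a - b).ofLp) j ^ 2 ≤
      2 * (M⁻¹ *ᵥ (a - c).ofLp) j ^ 2 + 2 * (M⁻¹ *ᵥ (b - c).ofLp) j ^ 2 := by
    intro a b c j
    have : M⁻¹ *ᵥ (a - b).ofLp = M⁻¹ *ᵥ (a - c).ofLp - M⁻¹ *ᵥ (b - c).ofLp := by
      rw [← Matrix.mulVec_sub, ← sub_sub_sub_cancel_right a b c]
      rfl
    rw [this, Pi.sub_apply]
    nlinarith [sq_nonneg ((M⁻¹ *ᵥ (a - c).ofLp) j + (M⁻¹ *ᵥ (b - c).ofLp) j)]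
  have hU : ∀ i, ∑ j, (M⁻¹ *ᵥ (fstPt x i - sndPt x i).ofLp) j ^ 2 / d j ≤ 4 * lam := by
    intro i
    calc _ ≤ ∑ j, (2 * ((M⁻¹ *ᵥ (fstPt x i - empMean x).ofLp) j ^ 2 / d j) +
          2 * ((M⁻¹ *ᵥ (sndPt x i - empMean x).ofLp) j ^ 2 / d j)) := by
          refine Finset.sum_le_sum fun j _ ↦ ?_
          rw [← mul_div_assoc, ← mul_div_assoc, ← add_div]
          exact div_le_div_of_nonneg_right (hsplit _ _ _ _) (hd j).le
      _ ≤ 4 * lam := by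
          rw [Finset.sum_add_distrib, ← Finset.mul_sum, ← Finset.mul_sum]
          have h1 := hxi ⟨i, by have := i.isLt; omega⟩
          have h2 := hxi ⟨i + n, by have := i.isLt; omega⟩
          rw [fstPt, sndPt]
          linarith
  have hV : ∀ i, ∑ j, (M⁻¹ *ᵥ (fstPt y i - sndPt y i).ofLp) j ^ 2 ≤ 4 * lam := by
    intro i
    refine (Finset.sum_le_sum fun j _ ↦ hsplit _ _ (empMean y) j).trans ?_
    rw [Finset.sum_add_distrib, ← Finset.mul_sum, ← Finset.mul_sum]
    have h1 := hyi ⟨i, by have := i.isLt; omega⟩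
    have h2 := hyi ⟨i + n, by have := i.isLt; omega⟩
    rw [fstPt, sndPt]
    linarith
  have h1V := fun j ↦ diag_of_empCov_eq hM hA' j
  obtain ⟨hqd, hsum⟩ := diag_cov_perturbation hn hlam.le hq hq0
    (fun i ↦ M⁻¹ *ᵥ (fstPt x i - sndPt x i).ofLp) (fun i ↦ M⁻¹ *ᵥ (fstPt y i - sndPt y i).ofLp)
    d hd (Finset.univ.filter fun i ↦ fstPt x i ≠ fstPt y i ∨ sndPt x i ≠ sndPt y i)
    (by
      refine le_trans (Nat.cast_le.2 (card_le_dist_H _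
        -- Each changed pair is charged to one position where the data sets differ; the first two
        -- thirds are disjoint, so no position is charged twice.
        (fun i : Fin n ↦ if fstPt x i ≠ fstPt y i then ⟨i, by have := i.isLt; omega⟩
          else ⟨i + n, by have := i.isLt; omega⟩) ?_ ?_)) hxy
      · intro i i' h
        have := i.isLt
        have := i'.isLt
        ext
        dsimp only at h
        split_ifs at h <;> simp only [Fin.mk.injEq] at h <;> omega
      · intro i hi
        simp only [Finset.mem_filter, Finset.mem_univ, true_and] at hi
        split_ifs with h
        · exact h
        · exact hi.resolve_left h)
    (by
      intro i hi
      simp only [Finset.mem_filter, Finset.mem_univ, true_and, not_or, not_not] at hi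
      simp only [hi.1, hi.2])
    (fun j ↦ diag_of_empCov_eq hM hB j) h1V hU hV
  refine ⟨M, d, hM, hd, hA, hB, hsum, ?_⟩
  -- Dimension zero is separate because the lower bound on `lam` below needs a coordinate.
  rcases isEmpty_or_nonempty (Fin m) with hm | ⟨⟨j₀⟩⟩
  · rw [Finset.univ_eq_empty, Finset.sum_empty]
    positivity
  -- In a single coordinate the `y`-covariance is `1` yet is half an average of terms bounded by
  -- `4λ`. Hence `λ ≥ 1/2`, which turns `2kλ/n ≤ 1/10` into `k ≤ n/10`.
  have hlam2 : 1 ≤ 2 * lam := by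
    have h1 : ∑ i, (M⁻¹ *ᵥ (fstPt y i - sndPt y i).ofLp) j₀ ^ 2 ≤ ∑ _i : Fin n, 4 * lam :=
      Finset.sum_le_sum fun i _ ↦ (Finset.single_le_sum
        (f := fun j ↦ (M⁻¹ *ᵥ (fstPt y i - sndPt y i).ofLp) j ^ 2)
        (fun j _ ↦ sq_nonneg _) (Finset.mem_univ j₀)).trans (hV i)
    rw [Finset.sum_const, nsmul_eq_mul, Finset.card_univ, Fintype.card_fin] at h1
    have h2 := mul_le_mul_of_nonneg_left h1 (by positivity : 0 ≤ 1 / (2 * (n : ℝ)))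
    rw [← h1V j₀] at h2
    have h3 : 1 / (2 * (n : ℝ)) * (n * (4 * lam)) = 2 * lam := by field_simp; ring
    linarith
  have hkn : k ≤ n / 10 := by
    rw [div_le_iff₀ hn'] at hsmall
    nlinarith
  set φ : EuclideanSpace ℝ (Fin m) →ₗ[ℝ] EuclideanSpace ℝ (Fin m) :=
    Matrix.toEuclideanLin M⁻¹ with hφ
  have hnorm : ∀ v, ‖φ v‖ ^ 2 = ∑ j, (M⁻¹ *ᵥ v.ofLp) j ^ 2 := fun v ↦ by
    rw [EuclideanSpace.real_norm_sq_eq]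
    rfl
  have hle : ∀ v, ∑ j, (M⁻¹ *ᵥ v.ofLp) j ^ 2 ≤ lam / q → ‖φ v‖ ≤ √(lam / q) := fun v hv ↦
    Real.le_sqrt_of_sq_le (by rwa [hnorm])
  have hq1 : q ≤ 1 := by
    rw [hq]
    have : 0 ≤ 2 * k * lam / n := by positivity
    linarith
  have hmain := norm_mean_sub_le hn (fun i ↦ φ (trdPt x i)) (fun i ↦ φ (trdPt y i))
    (Finset.univ.filter fun i ↦ trdPt x i ≠ trdPt y i) (k := k)
    (Real.sqrt_nonneg (lam / q)) (Real.sqrt_nonneg (lam / q))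
    (by
      refine le_trans (Nat.cast_le.2 (card_le_dist_H _
        (fun i : Fin n ↦ ⟨i + 2 * n, by have := i.isLt; omega⟩) ?_ ?_)) hxy
      · intro i i' h
        ext
        simp only [Fin.mk.injEq] at h
        omega
      · intro i hi
        simp only [Finset.mem_filter, Finset.mem_univ, true_and] at hi
        exact hi)
    (by
      intro i hi
      simp only [Finset.mem_filter, Finset.mem_univ, true_and, not_not] at hi
      simp only [hi])
    (mx := φ (empMean x)) (my := φ (empMean y))
    (by rw [empMean, map_smul, map_sum]) (by rw [empMean, map_smul, map_sum])
    (by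
      intro i
      rw [← map_sub]
      refine hle _ ?_
      rw [le_div_iff₀ hq0, Finset.sum_mul]
      refine (Finset.sum_le_sum fun j _ ↦ ?_).trans
        (hxi ⟨i + 2 * n, by have := i.isLt; omega⟩)
      rw [le_div_iff₀ (hd j), mul_assoc]
      exact mul_le_of_le_one_right (sq_nonneg _) (hqd j))
    (by
      intro i
      rw [← map_sub]
      refine hle _ ((hyi ⟨i + 2 * n, by have := i.isLt; omega⟩).trans ?_)
      rw [le_div_iff₀ hq0]
      exact mul_le_of_le_one_right hlam.le hq1)
  rw [← hnorm, map_sub]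
  set S := ‖φ (empMean x) - φ (empMean y)‖ with hS
  have hS0 : 0 ≤ S := norm_nonneg _
  -- From `n - k ≥ 9n/10`. Squaring gives the constant `4 · 100/81 < 8`.
  have h1 : 9 / 10 * n * S ≤ k * (2 * √(lam / q)) := by
    refine le_trans ?_ (hmain.trans_eq (by ring))
    exact mul_le_mul_of_nonneg_right (by linarith) hS0
  have h2 : (9 / 10 * n * S) ^ 2 ≤ (k * (2 * √(lam / q))) ^ 2 := by gcongr
  rw [mul_pow k, mul_pow 2, Real.sq_sqrt (by positivity)] at h2
  rw [le_div_iff₀ (by positivity)]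
  have h3 : (k ^ 2 * (2 ^ 2 * (lam / q))) * q = 4 * (k ^ 2 * lam) := by field_simp; norm_num
  have h4 := mul_le_mul_of_nonneg_right h2 hq0.le
  have h5 : 0 ≤ S ^ 2 * (q * n ^ 2) := by positivity
  nlinarith

open MeasureTheory ProbabilityTheory in
/-- Multivariate Gaussian probabilities in diagonalizing coordinates. -/
theorem multivariateGaussian_real_apply {m : ℕ} {M : Matrix (Fin m) (Fin m) ℝ} (hM : IsUnit M)
    {C : ℝ} (hC : C ≠ 0) (d : Fin m → ℝ) (hd : ∀ j, 0 ≤ d j) (v : EuclideanSpace ℝ (Fin m))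
    {s : Set (EuclideanSpace ℝ (Fin m))} (hs : MeasurableSet s) :
    (multivariateGaussian v (C ^ 2 • (M * Matrix.diagonal d * Mᵀ))).real s =
      (Measure.pi fun j ↦ gaussianReal ((C⁻¹ • (M⁻¹ *ᵥ v.ofLp)) j) (d j).toNNReal).real
        ((fun z : Fin m → ℝ ↦ (WithLp.toLp 2 ((C • M) *ᵥ z) : EuclideanSpace ℝ (Fin m))) ⁻¹' s) := by
  have hdet : IsUnit M.det := (Matrix.isUnit_iff_isUnit_det _).1 hM
  have hmeas : Measurable fun z : Fin m → ℝ ↦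
      (WithLp.toLp 2 ((C • M) *ᵥ z) : EuclideanSpace ℝ (Fin m)) :=
    ((PiLp.continuous_toLp 2 _).comp
      (Continuous.matrix_mulVec continuous_const continuous_id)).measurable
  have h1 : C ^ 2 • (M * Matrix.diagonal d * Mᵀ)
      = (C • M) * Matrix.diagonal d * (C • M)ᵀ := by
    rw [Matrix.transpose_smul, Matrix.mul_smul, Matrix.smul_mul, Matrix.smul_mul, smul_smul, sq]
  have h2 : v = WithLp.toLp 2 ((C • M) *ᵥ (C⁻¹ • (M⁻¹ *ᵥ v.ofLp))) := by
    rw [Matrix.mulVec_smul, Matrix.smul_mulVec, smul_smul, inv_mul_cancel₀ hC, one_smul,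
      Matrix.mulVec_mulVec, Matrix.mul_nonsing_inv _ hdet, Matrix.one_mulVec]
  rw [← map_measureReal_apply hmeas hs, map_pi_gaussianReal_eq_multivariateGaussian _ _ _ hd,
    ← h1, ← h2]

open ProbabilityTheory in
theorem multivariateGaussian_real_le_of_good {n m : ℕ} {ε δ lam k : ℝ}
    (hn : 0 < n) (hε : 0 < ε) (hδ : 0 < δ) (hlam : 0 < lam) (hk : 0 < k)
    (hnk : 2 * k * lam < (n : ℝ))
    (hεk : 10 * k * lam * (1 / ((n : ℝ) - 2 * k * lam) + 1 / (n : ℝ)) * Real.log (2 / δ) ≤ ε)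
    {C : ℝ}
    (hC : C ^ 2 = 32 * k ^ 2 / (ε ^ 2 * (n : ℝ) ^ 2) * (lam / (1 - 2 * k * lam / (n : ℝ)))
      * Real.log (1.25 / δ))
    {x y : DataSet n m} (hx : x ∈ Good n m lam) (hy : y ∈ Good n m lam)
    (hxy : (dist_H x y : ℝ) ≤ k) {s : Set (EuclideanSpace ℝ (Fin m))} (hs : MeasurableSet s) :
    (multivariateGaussian (empMean x) (C ^ 2 • empCov x)).real s ≤
      Real.exp (2 * ε) * (multivariateGaussian (empMean y) (C ^ 2 • empCov y)).real s
        + (1 + Real.exp ε) * δ := by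
  -- If `(1 + e^ε)δ ≥ 1` the bound is trivial. Otherwise `ε < log(1/δ)`, the smallness from which
  -- all later estimates start.
  rcases le_or_gt 1 ((1 + Real.exp ε) * δ) with htriv | hlt
  · have h1 : (multivariateGaussian (empMean x) (C ^ 2 • empCov x)).real s ≤ 1 :=
      MeasureTheory.measureReal_le_one
    have h2 : 0 ≤ Real.exp (2 * ε)
        * (multivariateGaussian (empMean y) (C ^ 2 • empCov y)).real s := by positivity
    linarith
  have hn' : (0 : ℝ) < n := by exact_mod_cast hn
  have hεδ : Real.exp ε * δ < 1 := by linarith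
  have hδ1 : δ ≤ 1 := by have := mul_pos (Real.exp_pos ε) hδ; linarith
  have hlogδ : ε < -Real.log δ := by
    have := Real.log_neg (by positivity) hεδ
    rw [Real.log_mul (Real.exp_pos _).ne' hδ.ne', Real.log_exp] at this
    linarith
  set L := Real.log (1.25 / δ) with hL
  have hLδ : -Real.log δ ≤ L := by
    rw [hL, Real.log_div (by norm_num) hδ.ne']
    have : 0 ≤ Real.log (1.25 : ℝ) := Real.log_nonneg (by norm_num)
    linarith
  have hL0 : 0 < L := by linarith
  have hL2 : ε < Real.log (2 / δ) := by
    rw [Real.log_div (by norm_num) hδ.ne']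
    have : 0 ≤ Real.log (2 : ℝ) := Real.log_nonneg (by norm_num)
    linarith
  obtain ⟨q, hq⟩ : ∃ q, q = 1 - 2 * k * lam / n := ⟨_, rfl⟩
  have hqn : q = (n - 2 * k * lam) / n := by rw [hq]; field_simp
  have hD : 0 < (n : ℝ) - 2 * k * lam := by linarith
  have hq0 : 0 < q := by rw [hqn]; positivity
  set τ := 2 * k * lam / n * (1 + 1 / q) with hτ
  have hτ0 : 0 < τ := by positivity
  have hετ : 5 * τ * Real.log (2 / δ) ≤ ε := by
    refine le_trans (le_of_eq ?_) hεk
    rw [hτ, hqn]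
    field_simp
    ring
  -- Since `5τ log(2/δ) ≤ ε < log(2/δ)`.
  have hτ5 : τ ≤ 1 / 5 := by
    by_contra! h
    have : 1 * Real.log (2 / δ) < 5 * τ * Real.log (2 / δ) :=
      mul_lt_mul_of_pos_right (by linarith) (by linarith)
    linarith
  have hr0 : 0 < 2 * k * lam / n := by positivity
  have hsmall : 2 * k * lam / n ≤ 1 / 10 := by
    have h1 : 1 ≤ 1 / q := by rw [le_div_iff₀ hq0, hq]; linarith
    have h2 : 2 * k * lam / n * 2 ≤ τ := by rw [hτ]; gcongr; linarith
    linarith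
  have hC0 : C ≠ 0 := by
    rintro rfl
    rw [← hq] at hC
    have : 0 < 32 * k ^ 2 / (ε ^ 2 * (n : ℝ) ^ 2) * (lam / q) * L := by positivity
    rw [← hC] at this
    norm_num at this
  obtain ⟨M, d, hM, hd, hA, hB, hcov, hmean⟩ :=
    exists_common_coordinates hn hlam hk hq hsmall hx hy hxy
  have hA' : empCov y = M * Matrix.diagonal (fun _ ↦ 1) * Mᵀ := by
    rw [Matrix.diagonal_one, Matrix.mul_one, hA]
  have hmeas : Measurable fun z : Fin m → ℝ ↦
      (WithLp.toLp 2 ((C • M) *ᵥ z) : EuclideanSpace ℝ (Fin m)) :=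
    ((PiLp.continuous_toLp 2 _).comp
      (Continuous.matrix_mulVec continuous_const continuous_id)).measurable
  -- The factor `32` in `C ^ 2` against the `8` in the mean bound leaves exactly `ε² / (4L)`.
  have hmean' : ∑ j, ((C⁻¹ • (M⁻¹ *ᵥ (empMean x).ofLp)) j
      - (C⁻¹ • (M⁻¹ *ᵥ (empMean y).ofLp)) j) ^ 2 ≤ ε ^ 2 / (4 * L) := by
    have h1 : ∀ j, ((C⁻¹ • (M⁻¹ *ᵥ (empMean x).ofLp)) j
        - (C⁻¹ • (M⁻¹ *ᵥ (empMean y).ofLp)) j) ^ 2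
        = (C ^ 2)⁻¹ * (M⁻¹ *ᵥ (empMean x - empMean y).ofLp) j ^ 2 := by
      intro j
      rw [WithLp.ofLp_sub, Matrix.mulVec_sub]
      simp only [Pi.smul_apply, Pi.sub_apply, smul_eq_mul]
      rw [← inv_pow]
      ring
    simp_rw [h1]
    rw [← Finset.mul_sum]
    refine (mul_le_mul_of_nonneg_left hmean (by positivity)).trans_eq ?_
    rw [hC, ← hq]
    field_simp
    norm_num
  -- The covariance changes first, at mean `μ_x`; the mean then moves under identity covariance. The
  -- second `δ` is therefore multiplied by `e^ε`.
  have step1 := pi_gaussianReal_real_le_of_mean_eq (C⁻¹ • (M⁻¹ *ᵥ (empMean x).ofLp)) d hd hτ0 hτ5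
    hδ hδ1 hcov hετ (hmeas hs)
  have step2 := pi_gaussianReal_real_le_of_var_one _ _ hε hδ (by linarith) hLδ hmean' (hmeas hs)
  rw [hB, hA', multivariateGaussian_real_apply hM hC0 d (fun j ↦ (hd j).le) _ hs,
    multivariateGaussian_real_apply hM hC0 _ (fun _ ↦ zero_le_one) _ hs]
  simp only [Real.toNNReal_one]
  have := mul_le_mul_of_nonneg_left step2 (Real.exp_pos ε).le
  rw [two_mul, Real.exp_add]
  linarith

end RescaledGaussian

theorem theorem4p11 (n d : ℕ) (ε δ lam k : ℝ)
    (hn : 0 < n) (hε : 0 < ε) (hδ : 0 < δ) (hlam : 0 < lam) (hk : 0 < k)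
    (hnk : 2 * k * lam < (n : ℝ))
    (hεk : 10 * k * lam * (1 / ((n : ℝ) - 2 * k * lam) + 1 / (n : ℝ)) * Real.log (2 / δ) ≤ ε)
    (C : ℝ)
    (hC : C ^ 2 = 32 * k ^ 2 / (ε ^ 2 * (n : ℝ) ^ 2) * (lam / (1 - 2 * k * lam / (n : ℝ)))
      * Real.log (1.25 / δ))
    (x y : RescaledGaussian.DataSet n d)
    (hx : x ∈ RescaledGaussian.Good n d lam) (hy : y ∈ RescaledGaussian.Good n d lam)
    (hxy : (RescaledGaussian.dist_H x y : ℝ) ≤ k) :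
    RescaledGaussian.Indistinguishable (2 * ε) ((1 + Real.exp ε) * δ)
      (ProbabilityTheory.multivariateGaussian (RescaledGaussian.empMean x)
        (C ^ 2 • RescaledGaussian.empCov x))
      (ProbabilityTheory.multivariateGaussian (RescaledGaussian.empMean y)
        (C ^ 2 • RescaledGaussian.empCov y)) :=
  fun s hs ↦ ⟨RescaledGaussian.multivariateGaussian_real_le_of_good hn hε hδ hlam hk hnk hεk hC
    hx hy hxy hs, RescaledGaussian.multivariateGaussian_real_le_of_good hn hε hδ hlam hk hnk hεk hC
    hy hx (by rwa [RescaledGaussian.dist_H, hammingDist_comm]) hs⟩
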